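/- All groups are abelian. An order unit of a partially ordered group $G$ is an element $u\ge 0$ such that every $g\in G$ satisfies $g\le nu$ for some $n\in\mathbf N$. A dimension group is a partially ordered abelian group that is directed, unperforated, and has the Riesz interpolation property; it is simple if it is nonzero and its only order ideals (convex directed subgroups) are $0$ and itself. For an order unit $u$ of $G$, the trace space $S(G,u)$ is the set of positive group homomorphisms $\tau:G\to\mathbf R$ with $\tau(u)=1$, with the topology of pointwise convergence; its extreme points are the pure traces, and they form the pure trace space. The pseudo-norm on $(G,u)$ is $\|g\|=\sup\{|\tau(g)|:\tau\in S(G,u)\}$. A dimension group with order unit is approximately divisible if every pure trace has dense range in $\mathbf R$. The class $\mathcal H$ of pro-finite-dimensional dimension groups consists of the dimension groups that are direct limits, over a nonempty directed set, of positive homomorphisms $\phi_{\alpha,\beta}:G_\alpha\to G_\beta$, where each $G_\alpha$ is an approximately divisible dimension group with order unit $u_\alpha$ and only finitely many pure traces, and each $\phi_{\alpha,\beta}(u_\alpha)$ is an order unit of $G_\beta$. A group homomorphism between partially ordered groups with order unit is continuous if it is continuous for the pseudo-norms; a homomorphism $\phi:H\to R$ is weakly continuous if $\rho\circ\phi$ is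 continuous for every continuous group homomorphism $\rho:R\to\mathbf R$. Let $I=[a,b]$ with $a<b$ be a closed real interval that contains no integer (for example, any closed interval of positive length in $(0,1)$). Let $R=\mathbf Z[x]$ with the strict ordering from $I$: $f<g$ if and only if $f(t)<g(t)$ for all $t\in I$. Then: 1. $R$ is an ordered ring and a simple dimension group, and $1$ is an order unit of $R$. 2. The map sending $t\in I$ to the evaluation $f\mapsto f(t)$ is a homeomorphism of $I$ onto the pure trace space of $(R,1)$, and the pseudo-norm of $(R,1)$ is the supremum norm on $I$. 3. $R$ is strongly anti-finite dimensional: for every $H\in\mathcal H$ (with any order unit), every continuous group homomorphism $H\to R$ is zero. 4. More strongly, for every $H\in\mathcal H$, every weakly continuous group homomorphism $H\to R$ is zero. Every order-preserving group homomorphism $H\to R$ is weakly continuous, and hence is zero. 5. $R$ is not a direct limit (over a directed set, with positive homomorphisms) of simple dimension groups with order unit each having only finitely many pure traces. -/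

import Mathlib

open scoped Polynomial

universe w₁ w₂ w₃ w₄

namespace DimGroup

section Basic

variable {G : Type*} [AddCommGroup G] [PartialOrder G]

/-- An order unit of a partially ordered abelian group: a positive element `u` such that
every element is bounded above by some multiple of `u`. -/
def IsOrderUnit (u : G) : Prop :=
  0 ≤ u ∧ ∀ g : G, ∃ n : ℕ, g ≤ n • u

variable (G) in
/-- A dimension group: a partially ordered abelian group that is directed, unperforated and has
the Riesz interpolation property. -/
structure IsDimensionGroup : Prop where
  isOrdered : IsOrderedAddMonoid G
  directed : ∀ x y : G, ∃ z, x ≤ z ∧ y ≤ z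
  unperforated : ∀ (n : ℕ) (x : G), 0 < n → 0 ≤ n • x → 0 ≤ x
  interpolation : ∀ x₁ x₂ y₁ y₂ : G, x₁ ≤ y₁ → x₁ ≤ y₂ → x₂ ≤ y₁ → x₂ ≤ y₂ →
    ∃ z, x₁ ≤ z ∧ x₂ ≤ z ∧ z ≤ y₁ ∧ z ≤ y₂

/-- An order ideal: a convex directed subgroup. -/
def IsOrderIdeal (J : AddSubgroup G) : Prop :=
  (J : Set G).OrdConnected ∧ DirectedOn (· ≤ ·) (J : Set G)

variable (G) in
/-- A partially ordered abelian group is simple if it is nonzero and has no order ideals other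
than `0` and itself. -/
def IsSimpleOrdered : Prop :=
  Nontrivial G ∧ ∀ J : AddSubgroup G, IsOrderIdeal J → J = ⊥ ∨ J = ⊤

/-- The trace space `S(G, u)`: the positive group homomorphisms `τ : G → ℝ` with `τ u = 1`, as a
subset of the space of all functions `G → ℝ` with the topology of pointwise convergence. -/
def traceSpace (u : G) : Set (G → ℝ) :=
  {τ | ∃ f : G →+ ℝ, (f : G → ℝ) = τ ∧ (∀ g, 0 ≤ g → 0 ≤ f g) ∧ f u = 1}

/-- The pure traces of `(G, u)`: the extreme points of `S(G, u)`. -/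
def pureTraces (u : G) : Set (G → ℝ) :=
  (traceSpace u).extremePoints ℝ

/-- For an order unit `u`, every pure trace of `(G, u)` has dense range in `ℝ`. -/
def IsApproximatelyDivisible (u : G) : Prop :=
  ∀ τ ∈ pureTraces u, Dense (Set.range τ)

/-- The pseudo-norm on `(G, u)` obtained from the affine representation: the supremum norm of
`τ ↦ τ g` on `S(G, u)`. -/
noncomputable def pseudoNorm (u : G) (g : G) : ℝ :=
  sSup ((fun τ : G → ℝ => |τ g|) '' traceSpace u)

/-- Continuity of a homomorphism to `ℝ` with respect to the pseudo-norm on `(G, u)`. -/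
def IsContinuousReal (u : G) (ρ : G →+ ℝ) : Prop :=
  ∀ g : G, ∀ ε > 0, ∃ δ > 0, ∀ g' : G, pseudoNorm u (g' - g) < δ → |ρ g' - ρ g| < ε

variable {H : Type*} [AddCommGroup H] [PartialOrder H]

/-- Continuity of a homomorphism with respect to the pseudo-norms on `(G, u)` and `(H, v)`. -/
def IsContinuousHom (u : G) (v : H) (φ : G →+ H) : Prop :=
  ∀ g : G, ∀ ε > 0, ∃ δ > 0, ∀ g' : G,
    pseudoNorm u (g' - g) < δ → pseudoNorm v (φ g' - φ g) < ε

/-- Weak continuity: the composition with every continuous homomorphism `H → ℝ` is continuous. -/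
def IsWeaklyContinuousHom (u : G) (v : H) (φ : G →+ H) : Prop :=
  ∀ ρ : H →+ ℝ, IsContinuousReal v ρ → IsContinuousReal u (ρ.comp φ)

end Basic

/-- A directed system of partially ordered abelian groups and positive homomorphisms, over a
(nonempty) directed set. -/
structure OrderedSystem where
  /-- the index set -/
  Idx : Type*
  /-- the groups -/
  Gp : Idx → Type*
  [preorder : Preorder Idx]
  [directed : IsDirectedOrder Idx]
  [nonempty : Nonempty Idx]
  [group : ∀ i, AddCommGroup (Gp i)]
  [order : ∀ i, PartialOrder (Gp i)]
  [ordered : ∀ i, IsOrderedAddMonoid (Gp i)]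
  /-- the connecting positive homomorphisms -/
  map : ∀ i j, i ≤ j → Gp i →+o Gp j
  [system : DirectedSystem Gp (map · · ·)]

attribute [instance] OrderedSystem.preorder OrderedSystem.directed OrderedSystem.nonempty
  OrderedSystem.group OrderedSystem.order OrderedSystem.ordered OrderedSystem.system

/-- `H` is (order isomorphic to) the direct limit of the system `S`, where the positive cone of the
direct limit consists of the classes of positive elements of the groups of the system. -/
def OrderedSystem.HasLimit (S : OrderedSystem) (H : Type*) [AddCommGroup H] [PartialOrder H] :
    Prop :=
  ∃ e : DirectLimit S.Gp S.map ≃+ H, ∀ x : DirectLimit S.Gp S.map,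
    0 ≤ e x ↔ ∃ (i : S.Idx) (g : S.Gp i), 0 ≤ g ∧ x = ⟦⟨i, g⟩⟧



/-- The class of pro-finite dimensional dimension groups: direct limits of approximately divisible
dimension groups with order unit that have finitely many pure traces, where the connecting maps
send the given order units to order units. -/
def IsProFD (H : Type w₁) [AddCommGroup H] [PartialOrder H] : Prop :=
  IsDimensionGroup H ∧
  ∃ (S : OrderedSystem.{w₂, w₃}) (u : ∀ i, S.Gp i),
    (∀ i, IsDimensionGroup (S.Gp i) ∧ IsOrderUnit (u i) ∧
      IsApproximatelyDivisible (u i) ∧ (pureTraces (u i)).Finite) ∧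
    (∀ i j (hij : i ≤ j), IsOrderUnit (S.map i j hij (u i))) ∧
    S.HasLimit H

/-- A dimension group `R` with order unit `v` is strongly anti-finite dimensional if every
continuous homomorphism from a pro-finite dimensional dimension group into it is zero. -/
def IsStronglyAntiFD {R : Type w₄} [AddCommGroup R] [PartialOrder R] (v : R) : Prop :=
  IsDimensionGroup R ∧ IsOrderUnit v ∧
  ∀ (H : Type w₁) [AddCommGroup H] [PartialOrder H], IsProFD.{w₁, w₂, w₃} H →
    ∀ u : H, IsOrderUnit u → ∀ φ : H →+ R, IsContinuousHom u v φ → φ = 0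

/-- The ring `ℤ[x]`, to be given the strict ordering from the interval `[a, b]`. -/
def StrictPoly (a b : ℝ) (_ : a < b) : Type := ℤ[X]

namespace StrictPoly

variable {a b : ℝ} {hab : a < b}

noncomputable instance : CommRing (StrictPoly a b hab) := inferInstanceAs (CommRing ℤ[X])

/-- The value at the real number `t` of a polynomial with integer coefficients. -/
noncomputable def eval (p : StrictPoly a b hab) (t : ℝ) : ℝ := Polynomial.aeval (A := ℝ) t (p : ℤ[X])

theorem eval_add (p q : StrictPoly a b hab) (t : ℝ) : eval (p + q) t = eval p t + eval q t :=
  map_add (Polynomial.aeval (R := ℤ) t) (p : ℤ[X]) (q : ℤ[X])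

/-- The strict ordering: `p < q` if and only if `p t < q t` for all `t` in `[a, b]`. -/
instance : PartialOrder (StrictPoly a b hab) where
  le p q := p = q ∨ ∀ t ∈ Set.Icc a b, eval p t < eval q t
  le_refl p := Or.inl rfl
  le_trans p q r hpq hqr := by
    rcases hpq with rfl | hpq
    · exact hqr
    · rcases hqr with rfl | hqr
      · exact Or.inr hpq
      · exact Or.inr fun t ht => (hpq t ht).trans (hqr t ht)
  le_antisymm p q hpq hqp := by
    rcases hpq with rfl | hpq
    · rfl
    · rcases hqp with rfl | hqp
      · rfl
      · have ha : a ∈ Set.Icc a b := ⟨le_rfl, hab.le⟩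
        exact absurd (hpq a ha) (hqp a ha).asymm

theorem le_def (p q : StrictPoly a b hab) :
    p ≤ q ↔ p = q ∨ ∀ t ∈ Set.Icc a b, eval p t < eval q t := Iff.rfl

end StrictPoly

end DimGroup

open DimGroup

/-! The vanishing statements rest on a clash between density and integrality. Let `G` be an
approximately divisible dimension group with finitely many pure traces. Distinct pure traces are
disjoint (`exists_split_of_pure`), so the pure traces together map `G` onto a dense subgroup of a
finite-dimensional space `V` (`denseRange_pi_of_pure`). If `ψ : G → ℤ[x]` is continuous after each
evaluation at a point of `I`, then each `g ↦ ψ(g)(t)` factors through a linear functional on `V`. A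
coefficient of a polynomial is a linear function of its values on the infinite set `I`, so each
coefficient of `ψ(g)` is also a linear functional on `V`. It is integer-valued on a dense set, hence
zero, and `ψ = 0` (`StrictPoly.eq_zero_of_continuous_eval`). For a direct limit this applies at
every stage.

If `ℤ[x]` were a limit of simple groups with finitely many pure traces, some stage would hit both
`1` and `X`. Either that stage is approximately divisible, and its map is zero, or some trace has
discrete range, which forces the stage to be cyclic. Both are impossible.

The structure of `ℤ[x]` itself comes from uniform density of integer polynomials in `C(I)`, which
gives interpolation, and from the multiplicativity of pure traces, which makes them evaluations. -/

namespace DimGroup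

open Set Topology

/-! ### Traces, pure traces and the pseudo-norm. -/

section Traces

variable {G : Type*} [AddCommGroup G] [PartialOrder G] {u : G}

theorem IsOrderUnit.abs_le [IsOrderedAddMonoid G] (hu : IsOrderUnit u) (g : G) :
    ∃ n : ℕ, ∀ f : G →+ ℝ, (∀ g, 0 ≤ g → 0 ≤ f g) → |f g| ≤ n * f u := by
  obtain ⟨n, hn⟩ := hu.2 g
  obtain ⟨m, hm⟩ := hu.2 (-g)
  refine ⟨n + m, fun f hf => ?_⟩
  have h1 := hf _ (sub_nonneg.2 hn)
  have h2 := hf _ (sub_nonneg.2 hm)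
  have h3 := hf _ hu.1
  simp only [map_sub, map_nsmul, map_neg, nsmul_eq_mul] at h1 h2
  push_cast
  rw [_root_.abs_le]
  have h4 : 0 ≤ (n : ℝ) * f u := by positivity
  have h5 : 0 ≤ (m : ℝ) * f u := by positivity
  constructor <;> linarith

theorem eq_zero_of_map_orderUnit [IsOrderedAddMonoid G] {f : G →+ ℝ} (hu : IsOrderUnit u) (hf : ∀ g, 0 ≤ g → 0 ≤ f g)
    (h : f u = 0) : f = 0 := by
  ext g
  obtain ⟨n, hn⟩ := hu.abs_le g
  have := hn f hf
  rw [h, mul_zero] at this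
  simpa using abs_nonpos_iff.1 this

theorem bddAbove_traces [IsOrderedAddMonoid G] (hu : IsOrderUnit u) (g : G) :
    BddAbove ((fun τ : G → ℝ => |τ g|) '' traceSpace u) := by
  obtain ⟨n, hn⟩ := hu.abs_le g
  refine ⟨n, ?_⟩
  rintro _ ⟨_, ⟨f, rfl, hf, h1⟩, rfl⟩
  simpa [h1] using hn f hf

theorem le_pseudoNorm [IsOrderedAddMonoid G] (hu : IsOrderUnit u) (g : G) {τ : G → ℝ} (hτ : τ ∈ traceSpace u) :
    |τ g| ≤ pseudoNorm u g :=
  le_csSup (bddAbove_traces hu g) ⟨τ, hτ, rfl⟩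

theorem pseudoNorm_nonneg (u g : G) : 0 ≤ pseudoNorm u g :=
  Real.sSup_nonneg (by rintro _ ⟨τ, -, rfl⟩; exact abs_nonneg _)

theorem pseudoNorm_le {g : G} {c : ℝ} (hc : 0 ≤ c) (h : ∀ τ ∈ traceSpace u, |τ g| ≤ c) :
    pseudoNorm u g ≤ c :=
  Real.sSup_le (by rintro _ ⟨τ, hτ, rfl⟩; exact h τ hτ) hc

theorem smul_mem_traceSpace {f : G →+ ℝ} (hf : ∀ g, 0 ≤ g → 0 ≤ f g) (h : 0 < f u) :
    (fun g => (f u)⁻¹ * f g) ∈ traceSpace u :=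
  ⟨(AddMonoidHom.mulLeft (f u)⁻¹).comp f, rfl,
    fun g hg => mul_nonneg (inv_nonneg.2 h.le) (hf g hg), inv_mul_cancel₀ h.ne'⟩

theorem abs_le_mul_pseudoNorm [IsOrderedAddMonoid G] (hu : IsOrderUnit u) {f : G →+ ℝ} (hf : ∀ g, 0 ≤ g → 0 ≤ f g)
    (g : G) : |f g| ≤ f u * pseudoNorm u g := by
  rcases (hf u hu.1).eq_or_lt with h | h
  · rw [eq_zero_of_map_orderUnit hu hf h.symm]; simp
  · have := le_pseudoNorm hu g (smul_mem_traceSpace hf h)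
    simp only [abs_mul, abs_inv, abs_of_pos h] at this
    rwa [inv_mul_le_iff₀ h] at this

/-- A positive homomorphism dominated by a pure trace is a multiple of it. -/
theorem eq_mul_of_le_pure [IsOrderedAddMonoid G] (hu : IsOrderUnit u) {f σ : G →+ ℝ} (hf : ⇑f ∈ pureTraces u)
    (hσ : ∀ g, 0 ≤ g → 0 ≤ σ g) (hle : ∀ g, 0 ≤ g → σ g ≤ f g) (g : G) : σ g = σ u * f g := by
  obtain ⟨⟨f', hff, hpos, h1⟩, hext⟩ := hf
  obtain rfl : f' = f := DFunLike.coe_injective hff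
  have hd : ∀ g, 0 ≤ g → 0 ≤ (f' - σ) g := fun g hg => sub_nonneg.2 (hle g hg)
  rcases (hσ u hu.1).eq_or_lt with h | h
  · rw [eq_zero_of_map_orderUnit hu hσ h.symm]; simp
  rcases (hd u hu.1).eq_or_lt with h' | h'
  · have h0 := eq_zero_of_map_orderUnit hu hd h'.symm
    have hs : σ = f' := (sub_eq_zero.1 h0).symm
    rw [hs, h1, one_mul]
  -- Normalising `σ` and `f' - σ` writes `f'` as a convex combination of two traces with weights `σ
  -- u` and `(f' - σ) u`; extremality identifies the first with `f'`.
  · have key := hext (smul_mem_traceSpace hσ h) (smul_mem_traceSpace hd h')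
      ⟨σ u, (f' - σ) u, h, h', by simp [h1], by
        ext g
        simp only [Pi.add_apply, Pi.smul_apply, smul_eq_mul]
        rw [mul_inv_cancel_left₀ h.ne', mul_inv_cancel_left₀ h'.ne']
        simp⟩
    have := congrFun key g
    rw [← this, mul_inv_cancel_left₀ h.ne']

theorem convex_traceSpace (u : G) : Convex ℝ (traceSpace u) := by
  rintro _ ⟨f, rfl, hf, hf1⟩ _ ⟨g, rfl, hg, hg1⟩ s t hs ht hst
  refine ⟨(AddMonoidHom.mulLeft s).comp f + (AddMonoidHom.mulLeft t).comp g, ?_, ?_, ?_⟩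
  · ext x; simp
  · intro x hx
    have := hf x hx
    have := hg x hx
    simp only [AddMonoidHom.add_apply, AddMonoidHom.comp_apply, AddMonoidHom.coe_mulLeft]
    positivity
  · simp [hf1, hg1, hst]

theorem isCompact_traceSpace [IsOrderedAddMonoid G] (hu : IsOrderUnit u) : IsCompact (traceSpace u) := by
  choose n hn using fun g : G => hu.abs_le g
  have hK : IsCompact (Set.univ.pi fun g : G => Icc (-(n g : ℝ)) (n g)) :=
    isCompact_univ_pi fun g => isCompact_Icc
  refine hK.of_isClosed_subset ?_ ?_
  · have : traceSpace u = (⋂ g, ⋂ h, {τ : G → ℝ | τ (g + h) = τ g + τ h}) ∩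
        (⋂ g, ⋂ (_ : 0 ≤ g), {τ : G → ℝ | 0 ≤ τ g}) ∩ {τ | τ u = 1} := by
      ext τ
      simp only [mem_inter_iff, mem_iInter, mem_ofPred_eq]
      constructor
      · rintro ⟨f, rfl, hf, h1⟩
        exact ⟨⟨map_add f, hf⟩, h1⟩
      · rintro ⟨⟨hadd, hpos⟩, h1⟩
        exact ⟨AddMonoidHom.mk' τ hadd, rfl, hpos, h1⟩
    rw [this]
    refine ((isClosed_iInter fun g => isClosed_iInter fun h => ?_).inter
      (isClosed_iInter fun g => isClosed_iInter fun _ => ?_)).inter ?_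
    · exact isClosed_eq (by fun_prop) (by fun_prop)
    · exact isClosed_le (by fun_prop) (by fun_prop)
    · exact isClosed_eq (by fun_prop) (by fun_prop)
  · rintro _ ⟨f, rfl, hf, h1⟩ g -
    have := hn g f hf
    rw [h1, mul_one] at this
    exact _root_.abs_le.1 this

/-- The pseudo-norm is bounded by any common bound of the pure traces. -/
theorem pseudoNorm_le_of_pure [IsOrderedAddMonoid G] (hu : IsOrderUnit u) {g : G} {c : ℝ} (hc : 0 ≤ c)
    (h : ∀ τ ∈ pureTraces u, |τ g| ≤ c) : pseudoNorm u g ≤ c := by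
  refine pseudoNorm_le hc fun τ hτ => ?_
  -- Krein–Milman: the bound at `g` cuts out a closed convex set of functions.
  rw [← closure_convexHull_extremePoints (isCompact_traceSpace hu) (convex_traceSpace u)] at hτ
  have hcl : IsClosed {τ : G → ℝ | τ g ∈ Icc (-c) c} :=
    isClosed_Icc.preimage (continuous_apply g)
  have hcv : Convex ℝ {τ : G → ℝ | τ g ∈ Icc (-c) c} :=
    (convex_Icc (-c) c).linear_preimage (LinearMap.proj (R := ℝ) (φ := fun _ : G => ℝ) g)
  have := closure_minimal (convexHull_min (fun σ hσ => ?_) hcv) hcl hτ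
  · exact _root_.abs_le.2 this
  · exact _root_.abs_le.1 (h σ hσ)

end Traces

/-! ### Riesz decomposition and joint density of pure traces. -/

section Riesz

variable {G : Type*} [AddCommGroup G] [PartialOrder G]

theorem IsDimensionGroup.exists_add [IsOrderedAddMonoid G] (hG : IsDimensionGroup G) {x g h : G}
    (hx : 0 ≤ x) (hg : 0 ≤ g) (hh : 0 ≤ h) (hxgh : x ≤ g + h) :
    ∃ y z, 0 ≤ y ∧ y ≤ g ∧ 0 ≤ z ∧ z ≤ h ∧ x = y + z := by
  obtain ⟨y, h1, h2, h3, h4⟩ := hG.interpolation 0 (x - h) x g hx hg (sub_le_self _ hh)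
    (sub_le_iff_le_add.2 hxgh)
  exact ⟨y, x - y, h1, h4, sub_nonneg.2 h3, sub_le_comm.1 h2, by abel⟩

theorem IsDimensionGroup.exists_nonneg_ge (hG : IsDimensionGroup G) (g : G) :
    ∃ p, 0 ≤ p ∧ g ≤ p :=
  hG.directed 0 g

theorem IsDimensionGroup.exists_sub [IsOrderedAddMonoid G] (hG : IsDimensionGroup G) (g : G) :
    ∃ p q, 0 ≤ p ∧ 0 ≤ q ∧ g = p - q := by
  obtain ⟨p, h0, hp⟩ := hG.exists_nonneg_ge g
  exact ⟨p, p - g, h0, sub_nonneg.2 hp, by abel⟩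

/-- Additivity on the cone makes `s q - s (q - g)` independent of the positive upper bound `q` of
`g`, and such a bound exists by directedness. -/
theorem exists_addMonoidHom_extend [IsOrderedAddMonoid G] (hG : IsDimensionGroup G) (s : G → ℝ)
    (hs : ∀ g h, 0 ≤ g → 0 ≤ h → s (g + h) = s g + s h) :
    ∃ σ : G →+ ℝ, ∀ g, 0 ≤ g → σ g = s g := by
  choose p h0 hp using hG.exists_nonneg_ge
  have key : ∀ g q, 0 ≤ q → g ≤ q → s (p g) - s (p g - g) = s q - s (q - g) := by
    intro g q hq hgq
    have h1 := hs (p g) (q - g) (h0 g) (sub_nonneg.2 hgq)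
    have h2 := hs q (p g - g) hq (sub_nonneg.2 (hp g))
    rw [show q + (p g - g) = p g + (q - g) by abel] at h2
    linarith
  refine ⟨AddMonoidHom.mk' (fun g => s (p g) - s (p g - g)) fun g h => ?_, fun g hg => ?_⟩
  · rw [key (g + h) (p g + p h) (add_nonneg (h0 g) (h0 h)) (add_le_add (hp g) (hp h)),
      hs _ _ (h0 g) (h0 h), show p g + p h - (g + h) = (p g - g) + (p h - h) by abel,
      hs _ _ (sub_nonneg.2 (hp g)) (sub_nonneg.2 (hp h))]
    ring
  · have h00 := hs 0 0 le_rfl le_rfl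
    rw [add_zero] at h00
    simp only [AddMonoidHom.mk'_apply, key g g hg le_rfl, sub_self]
    linarith

/-- Distinct pure traces are disjoint. -/
theorem exists_split_of_pure [IsOrderedAddMonoid G] (hG : IsDimensionGroup G) {u : G}
    (hu : IsOrderUnit u) {f₁ f₂ : G →+ ℝ} (h₁ : ⇑f₁ ∈ pureTraces u) (h₂ : ⇑f₂ ∈ pureTraces u)
    (hne : f₁ ≠ f₂) {g : G} (hg : 0 ≤ g) {ε : ℝ} (hε : 0 < ε) :
    ∃ x, 0 ≤ x ∧ x ≤ g ∧ f₁ (g - x) < ε ∧ f₂ x < ε := by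
  have pos : ∀ {f : G →+ ℝ}, ⇑f ∈ pureTraces u → (∀ g, 0 ≤ g → 0 ≤ f g) ∧ f u = 1 := by
    rintro f ⟨⟨f', hf', h⟩, -⟩
    obtain rfl := DFunLike.coe_injective hf'
    exact h
  obtain ⟨p₁, hu₁⟩ := pos h₁
  obtain ⟨p₂, hu₂⟩ := pos h₂
  let c : G → G → ℝ := fun g x => f₁ (g - x) + f₂ x
  have hc0 : ∀ g, 0 ≤ g → ∀ x ∈ Icc 0 g, 0 ≤ c g x := fun g _ x hx =>
    add_nonneg (p₁ _ (sub_nonneg.2 hx.2)) (p₂ _ hx.1)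
  -- On the cone this is the lattice meet of `f₁` and `f₂`; the aim is to show that it vanishes.
  let s : G → ℝ := fun g => sInf (c g '' Icc 0 g)
  have hbdd : ∀ g, 0 ≤ g → BddBelow (c g '' Icc 0 g) := fun g hg =>
    ⟨0, by rintro _ ⟨x, hx, rfl⟩; exact hc0 g hg x hx⟩
  have hle : ∀ g, 0 ≤ g → ∀ x ∈ Icc 0 g, s g ≤ c g x := fun g hg x hx =>
    csInf_le (hbdd g hg) ⟨x, hx, rfl⟩
  have hnem : ∀ g : G, 0 ≤ g → (c g '' Icc 0 g).Nonempty := fun g hg =>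
    (nonempty_Icc.2 hg).image _
  have hlt : ∀ g, 0 ≤ g → ∀ ε > 0, ∃ x ∈ Icc 0 g, c g x < s g + ε := by
    intro g hg ε hε
    obtain ⟨_, ⟨x, hx, rfl⟩, h⟩ := exists_lt_of_csInf_lt (hnem g hg)
      (show s g < s g + ε by linarith)
    exact ⟨x, hx, h⟩
  have hs0 : ∀ g, 0 ≤ g → 0 ≤ s g := fun g hg =>
    le_csInf (hnem g hg) (by rintro _ ⟨x, hx, rfl⟩; exact hc0 g hg x hx)
  have hcadd : ∀ g h x y, c (g + h) (x + y) = c g x + c h y := by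
    intro g h x y
    simp only [c, map_add, map_sub]
    ring
  have hadd : ∀ g h, 0 ≤ g → 0 ≤ h → s (g + h) = s g + s h := by
    intro g h hg hh
    apply le_antisymm
    · refine le_of_forall_pos_le_add fun ε hε => ?_
      obtain ⟨x, hx, hx'⟩ := hlt g hg (ε / 2) (by linarith)
      obtain ⟨y, hy, hy'⟩ := hlt h hh (ε / 2) (by linarith)
      have := hle (g + h) (add_nonneg hg hh) (x + y)
        ⟨add_nonneg hx.1 hy.1, add_le_add hx.2 hy.2⟩
      rw [hcadd] at this
      linarith
    · refine le_csInf (hnem _ (add_nonneg hg hh)) ?_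
      rintro _ ⟨z, hz, rfl⟩
      obtain ⟨x, y, hx0, hxg, hy0, hyh, rfl⟩ := hG.exists_add hz.1 hg hh hz.2
      rw [hcadd]
      exact add_le_add (hle g hg x ⟨hx0, hxg⟩) (hle h hh y ⟨hy0, hyh⟩)
  obtain ⟨σ, hσ⟩ := exists_addMonoidHom_extend hG s hadd
  have hσ0 : ∀ g, 0 ≤ g → 0 ≤ σ g := fun g hg => by rw [hσ g hg]; exact hs0 g hg
  have e₁ := eq_mul_of_le_pure hu h₁ hσ0 fun g hg => by
    rw [hσ g hg]; simpa [c] using hle g hg 0 ⟨le_rfl, hg⟩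
  have e₂ := eq_mul_of_le_pure hu h₂ hσ0 fun g hg => by
    rw [hσ g hg]; simpa [c] using hle g hg g ⟨hg, le_rfl⟩
  -- The meet lies below both pure traces, so it equals both `σ u • f₁` and `σ u • f₂`, and these
  -- differ unless `σ u = 0`.
  have hz : σ u = 0 := by
    by_contra hne'
    refine hne (DFunLike.ext _ _ fun g => ?_)
    exact mul_left_cancel₀ hne' ((e₁ g).symm.trans (e₂ g))
  obtain ⟨x, hx, hxε⟩ := hlt g hg ε hε
  rw [← hσ g hg, e₁ g, hz, zero_mul, zero_add] at hxε
  have a1 := p₁ _ (sub_nonneg.2 hx.2)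
  have a2 := p₂ _ hx.1
  exact ⟨x, hx.1, hx.2, by simp only [c] at hxε; linarith, by simp only [c] at hxε; linarith⟩

/-- The traces in `s` are made small one at a time, each time shrinking the previous element;
positivity preserves the bounds already obtained. -/
theorem exists_split_of_pure_finset [IsOrderedAddMonoid G] (hG : IsDimensionGroup G) {u : G}
    (hu : IsOrderUnit u) {ι : Type*} {f : ι → G →+ ℝ} (hf : ∀ i, ⇑(f i) ∈ pureTraces u)
    (hinj : Function.Injective f) (i : ι) (s : Finset ι) (hi : i ∉ s) {g : G} (hg : 0 ≤ g) {ε : ℝ}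
    (hε : 0 < ε) : ∃ x, 0 ≤ x ∧ x ≤ g ∧ f i (g - x) < ε ∧ ∀ j ∈ s, f j x < ε := by
  classical
  have pos : ∀ i g, 0 ≤ g → 0 ≤ f i g := by
    intro i
    obtain ⟨⟨f', hf', h, -⟩, -⟩ := hf i
    obtain rfl := DFunLike.coe_injective hf'
    exact h
  induction s using Finset.induction_on generalizing ε with
  | empty => exact ⟨g, hg, le_rfl, by simpa using hε, by simp⟩
  | insert k s hk ih =>
    obtain ⟨x, hx0, hxg, hx, hxs⟩ := ih (fun h => hi (Finset.mem_insert_of_mem h)) (half_pos hε)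
    obtain ⟨y, hy0, hyx, hy, hyk⟩ := exists_split_of_pure hG hu (hf i) (hf k)
      (fun h => hi (by rw [hinj h]; exact Finset.mem_insert_self _ _)) hx0 (half_pos hε)
    refine ⟨y, hy0, hyx.trans hxg, ?_, ?_⟩
    · have : g - y = (g - x) + (x - y) := by abel
      rw [this, map_add]
      linarith
    · intro j hj
      rcases Finset.mem_insert.1 hj with rfl | hj
      · linarith
      · have h1 := hxs j hj
        have h2 := pos j _ (sub_nonneg.2 hyx)
        rw [map_sub] at h2
        linarith

/-- The values of finitely many pure traces, each with dense range, are jointly dense. -/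
theorem denseRange_pi_of_pure [IsOrderedAddMonoid G] (hG : IsDimensionGroup G) {u : G}
    (hu : IsOrderUnit u) {ι : Type*} [Fintype ι] {f : ι → G →+ ℝ}
    (hf : ∀ i, ⇑(f i) ∈ pureTraces u) (hinj : Function.Injective f)
    (hd : ∀ i, DenseRange (f i)) : DenseRange (AddMonoidHom.pi f) := by
  classical
  have pos : ∀ i g, 0 ≤ g → 0 ≤ f i g := by
    intro i
    obtain ⟨⟨f', hf', h, -⟩, -⟩ := hf i
    obtain rfl := DFunLike.coe_injective hf'
    exact h
  set D := (AddMonoidHom.pi f).range.topologicalClosure with hD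
  have hDcl : IsClosed (D : Set (ι → ℝ)) := AddSubgroup.isClosed_topologicalClosure _
  -- Splitting gives `x ≤ g` carrying almost all of `f i g` and almost nothing of the other traces.
  have h1 : ∀ i g, 0 ≤ g → Pi.single i (f i g) ∈ D := by
    intro i g hg
    rw [hD, ← SetLike.mem_coe, AddSubgroup.topologicalClosure_coe, Metric.mem_closure_iff]
    intro ε hε
    obtain ⟨x, hx0, hxg, hxi, hx⟩ := exists_split_of_pure_finset hG hu hf hinj i
      (Finset.univ.erase i) (Finset.notMem_erase _ _) hg hε
    refine ⟨AddMonoidHom.pi f x, ⟨x, rfl⟩, (dist_pi_lt_iff hε).2 fun j => ?_⟩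
    by_cases hj : j = i
    · subst hj
      rw [Pi.single_eq_same, Real.dist_eq, AddMonoidHom.pi_apply, ← map_sub,
        abs_of_nonneg (pos _ _ (sub_nonneg.2 hxg))]
      exact hxi
    · rw [Pi.single_eq_of_ne hj, Real.dist_eq, AddMonoidHom.pi_apply, zero_sub, abs_neg,
        abs_of_nonneg (pos _ _ hx0)]
      exact hx j (Finset.mem_erase.2 ⟨hj, Finset.mem_univ _⟩)
  have h2 : ∀ i g, Pi.single i (f i g) ∈ D := by
    intro i g
    obtain ⟨p, q, hp, hq, rfl⟩ := hG.exists_sub g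
    rw [map_sub, Pi.single_sub]
    exact D.sub_mem (h1 i p hp) (h1 i q hq)
  have h3 : ∀ i (r : ℝ), Pi.single i r ∈ D := by
    intro i r
    refine (hd i).induction_on (p := fun r => Pi.single i r ∈ D) r ?_ (h2 i)
    exact hDcl.preimage (continuous_single i)
  intro v
  have : v ∈ D := by
    rw [← Finset.univ_sum_single v]
    exact D.sum_mem fun i _ => h3 i _
  exact this

end Riesz

/-! ### Linear extension from dense subgroups. -/

section Extension

/-- A homomorphism to `ℝ` that is small where a dense finite-dimensional representation is small
factors through a linear functional. -/
theorem exists_linearMap_of_denseRange {G ι : Type*} [AddCommGroup G] [Fintype ι]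
    (T : G →+ (ι → ℝ)) (hT : DenseRange T) (f : G →+ ℝ)
    (hf : ∀ ε > 0, ∃ δ > 0, ∀ g, ‖T g‖ < δ → |f g| < ε) :
    ∃ L : (ι → ℝ) →ₗ[ℝ] ℝ, ∀ g, L (T g) = f g := by
  -- For the pseudometric pulled back along `T`, `f` is uniformly continuous, so it extends to the
  -- whole space; a continuous additive map is real linear.
  let : PseudoMetricSpace G := PseudoMetricSpace.induced T inferInstance
  have hTi : IsUniformInducing T := ⟨rfl⟩
  have hfu : UniformContinuous f := by
    rw [Metric.uniformContinuous_iff]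
    intro ε hε
    obtain ⟨δ, hδ, h⟩ := hf ε hε
    refine ⟨δ, hδ, fun {x y} hxy => ?_⟩
    rw [Real.dist_eq, ← map_sub]
    refine h _ ?_
    rw [map_sub, ← dist_eq_norm]
    exact hxy
  have hFc := (uniformContinuous_uniformly_extend hTi hT hfu).continuous
  have hF : ∀ g, (hTi.isDenseInducing hT).extend f (T g) = f g :=
    uniformly_extend_of_ind hTi hT hfu
  set F := (hTi.isDenseInducing hT).extend f
  have hadd : ∀ x y, F (x + y) = F x + F y := by
    intro x y
    refine hT.induction_on₂ (p := fun x y => F (x + y) = F x + F y) ?_ ?_ x y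
    · exact isClosed_eq (by fun_prop) (by fun_prop)
    · intro g h
      rw [← map_add, hF, hF, hF, map_add]
  exact ⟨((AddMonoidHom.mk' F hadd).toRealLinearMap hFc).toLinearMap, hF⟩

/-- A linear functional taking integer values on a dense set vanishes. -/
theorem linearMap_eq_zero_of_denseRange_int {G ι : Type*} [Fintype ι] (T : G → (ι → ℝ))
    (hT : DenseRange T) (K : (ι → ℝ) →ₗ[ℝ] ℝ) (hK : ∀ g, ∃ n : ℤ, K (T g) = n) : K = 0 := by
  have hKc : Continuous K := K.continuous_of_finiteDimensional
  have hall : ∀ v, K v ∈ range ((↑) : ℤ → ℝ) := by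
    intro v
    refine hT.induction_on (p := fun v => K v ∈ range ((↑) : ℤ → ℝ)) v ?_ ?_
    · exact Int.isClosedEmbedding_coe_real.isClosed_range.preimage hKc
    · intro g
      obtain ⟨n, hn⟩ := hK g
      exact ⟨n, hn.symm⟩
  ext1 v
  by_contra hv
  have hv' : K v ≠ 0 := hv
  -- This multiple of `v` has value `1/2`, which is not an integer.
  obtain ⟨n, hn⟩ := hall ((2 * K v)⁻¹ • v)
  rw [map_smul, smul_eq_mul, mul_inv, mul_assoc, inv_mul_cancel₀ hv', mul_one] at hn
  have : (2 * n : ℝ) = 1 := by rw [hn]; norm_num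
  have h2 : (2 * n : ℤ) = 1 := by exact_mod_cast this
  omega

end Extension

/-! ### Simple groups with a trace of discrete range. -/

section Simple

variable {G : Type*} [AddCommGroup G] [PartialOrder G]

/-- The order ideal of elements bounded by multiples of a positive element. -/
def boundedSubgroup [IsOrderedAddMonoid G] (p : G) : AddSubgroup G where
  carrier := {g | ∃ n : ℕ, -(n • p) ≤ g ∧ g ≤ n • p}
  zero_mem' := ⟨0, by simp⟩
  add_mem' := by
    rintro x y ⟨n, h1, h2⟩ ⟨m, h3, h4⟩
    refine ⟨n + m, ?_, ?_⟩
    · rw [add_nsmul, neg_add]; exact add_le_add h1 h3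
    · rw [add_nsmul]; exact add_le_add h2 h4
  neg_mem' := by
    rintro x ⟨n, h1, h2⟩
    exact ⟨n, neg_le_neg h2, neg_le.1 h1⟩

theorem IsSimpleOrdered.isOrderUnit [IsOrderedAddMonoid G] (hS : IsSimpleOrdered G) {p : G}
    (hp : 0 < p) : IsOrderUnit p := by
  have hI : IsOrderIdeal (boundedSubgroup p) := by
    constructor
    · constructor
      rintro x ⟨n, h1, -⟩ y ⟨m, -, h4⟩ z ⟨hxz, hzy⟩
      refine ⟨n + m, ?_, ?_⟩
      · refine le_trans (neg_le_neg ?_) (h1.trans hxz)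
        exact nsmul_le_nsmul_left hp.le (Nat.le_add_right _ _)
      · exact (hzy.trans h4).trans (nsmul_le_nsmul_left hp.le (Nat.le_add_left _ _))
    · rintro x ⟨n, h1, h2⟩ y ⟨m, h3, h4⟩
      refine ⟨(n + m) • p, ⟨n + m, ?_, le_rfl⟩, ?_, ?_⟩
      · exact (neg_nonpos.2 (nsmul_nonneg hp.le _)).trans (nsmul_nonneg hp.le _)
      · exact h2.trans (nsmul_le_nsmul_left hp.le (Nat.le_add_right _ _))
      · exact h4.trans (nsmul_le_nsmul_left hp.le (Nat.le_add_left _ _))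
  refine ⟨hp.le, fun g => ?_⟩
  have hmem : p ∈ boundedSubgroup p :=
    ⟨1, by simpa using (neg_nonpos.2 hp.le).trans hp.le, by simp⟩
  rcases hS.2 _ hI with h | h
  · rw [h, AddSubgroup.mem_bot] at hmem
    exact absurd hmem hp.ne'
  · have : g ∈ boundedSubgroup p := h ▸ AddSubgroup.mem_top g
    obtain ⟨n, -, hn⟩ := this
    exact ⟨n, hn⟩

/-- In a group with Riesz decomposition, the positive elements below a multiple of an atom are
multiples of the atom. -/
theorem IsDimensionGroup.exists_nsmul_of_atom [IsOrderedAddMonoid G] (hG : IsDimensionGroup G)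
    {p : G} (hp : 0 ≤ p) (hatom : ∀ h, 0 ≤ h → h ≤ p → h = 0 ∨ h = p) (n : ℕ) (x : G) (hx : 0 ≤ x)
    (hxn : x ≤ n • p) : ∃ m : ℕ, x = m • p := by
  induction n generalizing x with
  | zero => exact ⟨0, by rw [zero_nsmul] at hxn ⊢; exact le_antisymm hxn hx⟩
  | succ n ih =>
    rw [succ_nsmul] at hxn
    obtain ⟨y, z, hy0, hy, hz0, hz, rfl⟩ := hG.exists_add hx (nsmul_nonneg hp n) hp hxn
    obtain ⟨m, rfl⟩ := ih y hy0 hy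
    rcases hatom z hz0 hz with rfl | rfl
    · exact ⟨m, by simp⟩
    · exact ⟨m + 1, by rw [succ_nsmul]⟩

/-- A simple dimension group with a trace whose range is not dense is cyclic. -/
theorem exists_zsmul_of_not_dense [IsOrderedAddMonoid G] (hG : IsDimensionGroup G)
    (hS : IsSimpleOrdered G) {u : G} (hu : IsOrderUnit u) {f : G →+ ℝ}
    (hf : ∀ g, 0 ≤ g → 0 ≤ f g) (hf1 : f u = 1) (hd : ¬ DenseRange f) :
    ∃ p : G, ∀ g, ∃ m : ℤ, g = m • p := by
  have hpos : ∀ g, 0 < g → 0 < f g := by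
    intro g hg
    refine (hf g hg.le).lt_of_ne fun h => ?_
    have := eq_zero_of_map_orderUnit (hS.isOrderUnit hg) hf h.symm
    rw [this] at hf1
    simp at hf1
  obtain ⟨c, hc⟩ := (AddSubgroup.dense_or_cyclic f.range).resolve_left hd
  have hfm : ∀ g, ∃ m : ℤ, f g = m * c := by
    intro g
    have : f g ∈ AddSubgroup.closure {c} := hc ▸ ⟨g, rfl⟩
    obtain ⟨m, hm⟩ := AddSubgroup.mem_closure_singleton.1 this
    exact ⟨m, by simpa using hm.symm⟩
  have hc0 : c ≠ 0 := by
    rintro rfl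
    obtain ⟨m, hm⟩ := hfm u
    rw [hf1] at hm
    simp at hm
  have hc' : 0 < |c| := abs_pos.2 hc0
  have hfn : ∀ g, 0 ≤ g → ∃ n : ℕ, f g = n * |c| := by
    intro g hg
    obtain ⟨m, hm⟩ := hfm g
    refine ⟨m.natAbs, ?_⟩
    rw [← abs_of_nonneg (hf g hg), hm, abs_mul, Nat.cast_natAbs, Int.cast_abs]
  have hu0 : 0 < u := hu.1.lt_of_ne (by rintro rfl; simp at hf1)
  -- An element of least trace among the strictly positive ones is an atom, since `f` is strictly
  -- positive on them by simplicity.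
  let P : ℕ → Prop := fun n => ∃ g, 0 < g ∧ f g = n * |c|
  have hP : ∃ n, P n := by
    obtain ⟨n, hn⟩ := hfn u hu.1
    exact ⟨n, u, hu0, hn⟩
  classical
  obtain ⟨p, hp0, hp⟩ := Nat.find_spec hP
  have hmin : ∀ g, 0 < g → f p ≤ f g := by
    intro g hg
    obtain ⟨n, hn⟩ := hfn g hg.le
    rw [hp, hn]
    have : Nat.find hP ≤ n := Nat.find_min' hP ⟨g, hg, hn⟩
    gcongr
  have hatom : ∀ h, 0 ≤ h → h ≤ p → h = 0 ∨ h = p := by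
    intro h h0 hhp
    rcases h0.eq_or_lt with h0 | h0
    · exact Or.inl h0.symm
    refine Or.inr (hhp.eq_or_lt.resolve_right fun hlt => ?_)
    have h1 := hmin h h0
    have h2 := hpos _ (sub_pos.2 hlt)
    rw [map_sub] at h2
    linarith
  have hpn : ∀ x, 0 ≤ x → ∃ m : ℕ, x = m • p := by
    intro x hx
    obtain ⟨n, hn⟩ := (hS.isOrderUnit hp0).2 x
    exact hG.exists_nsmul_of_atom hp0.le hatom n x hx hn
  refine ⟨p, fun g => ?_⟩
  obtain ⟨x, y, hx, hy, rfl⟩ := hG.exists_sub g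
  obtain ⟨m, rfl⟩ := hpn x hx
  obtain ⟨n, rfl⟩ := hpn y hy
  exact ⟨m - n, by rw [sub_zsmul]; simp [sub_eq_add_neg]⟩

end Simple

end DimGroup

namespace DimGroup

open Set Topology Filter

/-! ### Uniform approximation by integer polynomials. -/

section Approximation

/-- Bernstein polynomials with the coefficients of `t^k (1-t)^(n-k)` rounded down. Each of the `n +
1` roundings costs at most `c^n`, where `c < 1` bounds `t` and `1 - t`, and `(n + 1) c^n → 0`. -/
theorem exists_int_poly_near_unitInterval {a b : ℝ} (ha : 0 < a) (hb : b < 1) {F : ℝ → ℝ}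
    (hF : Continuous F) {ε : ℝ} (hε : 0 < ε) :
    ∃ p : ℤ[X], ∀ t ∈ Icc a b, |Polynomial.aeval t p - F t| < ε := by
  by_cases hab : b < a
  · exact ⟨0, fun t ht => absurd (ht.1.trans ht.2) (not_le.2 hab)⟩
  rw [not_lt] at hab
  let f : C(unitInterval, ℝ) := ⟨fun x => F x, by fun_prop⟩
  let c := max b (1 - a)
  have hc0 : 0 ≤ c := le_max_of_le_left (ha.le.trans hab)
  have hc1 : c < 1 := max_lt hb (by linarith)
  have h1 := (Metric.tendsto_nhds.1 (bernsteinApproximation_uniform f)) (ε / 2) (half_pos hε)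
  have h2 : Tendsto (fun n : ℕ => n * c ^ n + c ^ n) atTop (𝓝 0) := by
    simpa using (tendsto_self_mul_const_pow_of_lt_one hc0 hc1).add
      (tendsto_pow_atTop_nhds_zero_of_lt_one hc0 hc1)
  obtain ⟨n, hn1, hn2⟩ := (h1.and (h2.eventually_lt_const (half_pos hε))).exists
  let z : Fin (n + 1) → ℝ := fun k => f (bernstein.z k) * n.choose k
  refine ⟨∑ k : Fin (n + 1), Polynomial.C ⌊z k⌋ * Polynomial.X ^ (k : ℕ) *
    (1 - Polynomial.X) ^ (n - k), fun t ht => ?_⟩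
  have ht' : t ∈ unitInterval := ⟨ha.le.trans ht.1, ht.2.trans hb.le⟩
  have e1 : |bernsteinApproximation n f ⟨t, ht'⟩ - F t| < ε / 2 := by
    have := (ContinuousMap.dist_lt_iff (half_pos hε)).1 hn1 ⟨t, ht'⟩
    rwa [Real.dist_eq] at this
  have e2 : |Polynomial.aeval t (∑ k : Fin (n + 1), Polynomial.C ⌊z k⌋ * Polynomial.X ^ (k : ℕ) *
      (1 - Polynomial.X) ^ (n - k)) - bernsteinApproximation n f ⟨t, ht'⟩| ≤ n * c ^ n + c ^ n := by
    rw [bernsteinApproximation.apply, map_sum, ← Finset.sum_sub_distrib]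
    refine (Finset.abs_sum_le_sum_abs _ _).trans ?_
    have : ∀ k ∈ (Finset.univ : Finset (Fin (n + 1))),
        |Polynomial.aeval t (Polynomial.C ⌊z k⌋ * Polynomial.X ^ (k : ℕ) *
          (1 - Polynomial.X) ^ (n - k)) - bernstein n k ⟨t, ht'⟩ • f (bernstein.z k)| ≤ c ^ n := by
      intro k _
      have hk : (k : ℕ) + (n - k) = n := by have := k.is_le; omega
      have : Polynomial.aeval t (Polynomial.C ⌊z k⌋ * Polynomial.X ^ (k : ℕ) *
          (1 - Polynomial.X) ^ (n - k)) - bernstein n k ⟨t, ht'⟩ • f (bernstein.z k) =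
          -(Int.fract (z k) * (t ^ (k : ℕ) * (1 - t) ^ (n - k))) := by
        simp only [map_mul, map_pow, map_sub, map_one, Polynomial.aeval_X, map_intCast,
          bernstein_apply, smul_eq_mul, Int.fract, eq_intCast]
        simp only [z]
        ring
      rw [this, abs_neg, abs_mul, abs_of_nonneg (Int.fract_nonneg _)]
      have p1 : |t ^ (k : ℕ) * (1 - t) ^ (n - k)| ≤ c ^ n := by
        have h0 : 0 ≤ t := ht'.1
        have h0' : 0 ≤ 1 - t := by linarith [ht'.2]
        rw [abs_of_nonneg (by positivity), show c ^ n = c ^ (k : ℕ) * c ^ (n - k) by rw [← pow_add, hk]]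
        have q1 : t ≤ c := ht.2.trans (le_max_left _ _)
        have q2 : 1 - t ≤ c := le_max_of_le_right (by linarith [ht.1])
        gcongr
      calc _ ≤ 1 * c ^ n := by
            gcongr
            exact (Int.fract_lt_one _).le
        _ = _ := one_mul _
    refine (Finset.sum_le_sum this).trans ?_
    simp [add_mul]
  have := abs_sub_le (Polynomial.aeval t (∑ k : Fin (n + 1), Polynomial.C ⌊z k⌋ *
    Polynomial.X ^ (k : ℕ) * (1 - Polynomial.X) ^ (n - k)))
    (bernsteinApproximation n f ⟨t, ht'⟩) (F t)
  linarith

/-- On a compact interval without integers, polynomials with integer coefficients are uniformly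
dense among continuous functions. -/
theorem exists_int_poly_near {a b : ℝ} (hab : a < b) (hI : ∀ n : ℤ, (n : ℝ) ∉ Icc a b)
    {F : ℝ → ℝ} (hF : Continuous F) {ε : ℝ} (hε : 0 < ε) :
    ∃ p : ℤ[X], ∀ t ∈ Icc a b, |Polynomial.aeval t p - F t| < ε := by
  -- The interval lies strictly between consecutive integers, so an integer translation moves it
  -- inside `(0, 1)`.
  have h1 : (⌊a⌋ : ℝ) < a := (Int.floor_le a).lt_of_ne fun h => hI ⌊a⌋ (by
    rw [h]; exact ⟨le_rfl, hab.le⟩)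
  have h2 : b < ⌊a⌋ + 1 := by
    by_contra h
    exact hI (⌊a⌋ + 1) (by
      push_cast
      exact ⟨(Int.lt_floor_add_one a).le, not_lt.1 h⟩)
  obtain ⟨p, hp⟩ := exists_int_poly_near_unitInterval (sub_pos.2 h1)
    (show b - ⌊a⌋ < 1 by linarith) (F := fun t => F (t + ⌊a⌋)) (by fun_prop) hε
  refine ⟨p.comp (Polynomial.X - Polynomial.C ⌊a⌋), fun t ht => ?_⟩
  have := hp (t - ⌊a⌋) ⟨sub_le_sub_right ht.1 _, sub_le_sub_right ht.2 _⟩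
  simpa [Polynomial.aeval_comp] using this

end Approximation

/-! ### Order structure and pure traces of `ℤ[x]`. -/

namespace StrictPoly

variable {a b : ℝ} {hab : a < b}

/-- Evaluation at `t` as a ring homomorphism. -/
noncomputable def evalHom (t : ℝ) : StrictPoly a b hab →+* ℝ :=
  (Polynomial.aeval (R := ℤ) t : ℤ[X] →ₐ[ℤ] ℝ).toRingHom

theorem continuous_eval (p : StrictPoly a b hab) : Continuous (eval p) :=
  Polynomial.continuous_aeval (p : ℤ[X])

theorem eval_sub (p q : StrictPoly a b hab) (t : ℝ) : eval (p - q) t = eval p t - eval q t :=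
  map_sub (evalHom t) p q

theorem eval_mul (p q : StrictPoly a b hab) (t : ℝ) : eval (p * q) t = eval p t * eval q t :=
  map_mul (evalHom t) p q

theorem eval_pow (p : StrictPoly a b hab) (n : ℕ) (t : ℝ) : eval (p ^ n) t = eval p t ^ n :=
  map_pow (evalHom t) p n

theorem eval_zero (t : ℝ) : eval (0 : StrictPoly a b hab) t = 0 := map_zero (evalHom t)

theorem eval_one (t : ℝ) : eval (1 : StrictPoly a b hab) t = 1 := map_one (evalHom t)

theorem eval_intCast (n : ℤ) (t : ℝ) : eval (n : StrictPoly a b hab) t = n :=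
  map_intCast (evalHom t) n

theorem eval_natCast (n : ℕ) (t : ℝ) : eval (n : StrictPoly a b hab) t = n :=
  map_natCast (evalHom t) n

theorem eval_nsmul (n : ℕ) (p : StrictPoly a b hab) (t : ℝ) : eval (n • p) t = n * eval p t :=
  (map_nsmul (evalHom t) n p).trans (nsmul_eq_mul _ _)

instance : IsDomain (StrictPoly a b hab) := inferInstanceAs (IsDomain ℤ[X])

instance : CharZero (StrictPoly a b hab) := inferInstanceAs (CharZero ℤ[X])

theorem le_of_lt_eval {p q : StrictPoly a b hab} (h : ∀ t ∈ Icc a b, eval p t < eval q t) :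
    p ≤ q := Or.inr h

theorem eval_le {p q : StrictPoly a b hab} (h : p ≤ q) {t : ℝ} (ht : t ∈ Icc a b) :
    eval p t ≤ eval q t := by
  rcases h with rfl | h
  · exact le_rfl
  · exact (h t ht).le

instance : IsOrderedRing (StrictPoly a b hab) where
  add_le_add_left p q h r := by
    rcases h with rfl | h
    · exact le_rfl
    · exact le_of_lt_eval fun t ht => by simpa [eval_add] using h t ht
  zero_le_one := le_of_lt_eval fun t _ => by simp [eval_zero, eval_one]
  mul_le_mul_of_nonneg_left r hr p q h := by
    rcases h with rfl | h
    · exact le_rfl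
    rcases hr with rfl | hr
    · simp
    refine le_of_lt_eval fun t ht => ?_
    have h0 := hr t ht
    rw [eval_zero] at h0
    simpa only [eval_mul] using mul_lt_mul_of_pos_left (h t ht) h0
  mul_le_mul_of_nonneg_right r hr p q h := by
    rcases h with rfl | h
    · exact le_rfl
    rcases hr with rfl | hr
    · simp
    refine le_of_lt_eval fun t ht => ?_
    have h0 := hr t ht
    rw [eval_zero] at h0
    simpa only [eval_mul] using mul_lt_mul_of_pos_right (h t ht) h0

theorem exists_abs_eval_le (p : StrictPoly a b hab) :
    ∃ n : ℕ, ∀ t ∈ Icc a b, |eval p t| < n := by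
  obtain ⟨C, hC⟩ := isCompact_Icc.exists_bound_of_continuousOn
    (continuous_eval p).continuousOn (s := Icc a b)
  obtain ⟨n, hn⟩ := exists_nat_gt C
  exact ⟨n, fun t ht => (hC t ht).trans_lt hn⟩

theorem isOrderUnit_one : IsOrderUnit (1 : StrictPoly a b hab) := by
  refine ⟨zero_le_one, fun p => ?_⟩
  obtain ⟨n, hn⟩ := exists_abs_eval_le p
  refine ⟨n, le_of_lt_eval fun t ht => ?_⟩
  rw [eval_nsmul, eval_one, mul_one]
  exact (abs_lt.1 (hn t ht)).2

theorem isDimensionGroup (hI : ∀ n : ℤ, (n : ℝ) ∉ Icc a b) :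
    IsDimensionGroup (StrictPoly a b hab) where
  isOrdered := inferInstance
  directed p q := by
    obtain ⟨n, hn⟩ := isOrderUnit_one.2 p
    obtain ⟨m, hm⟩ := isOrderUnit_one.2 q
    exact ⟨(n + m) • 1, hn.trans (nsmul_le_nsmul_left zero_le_one (Nat.le_add_right _ _)),
      hm.trans (nsmul_le_nsmul_left zero_le_one (Nat.le_add_left _ _))⟩
  unperforated n p hn h := by
    rcases h with h | h
    · have h' := h.symm
      rw [nsmul_eq_mul, mul_eq_zero] at h'
      rcases h' with h' | h'
      · exact absurd (Nat.cast_eq_zero.1 h') hn.ne'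
      · exact h'.ge
    · refine le_of_lt_eval fun t ht => ?_
      have := h t ht
      rw [eval_nsmul, eval_zero] at this
      rw [eval_zero]
      exact pos_of_mul_pos_right this (Nat.cast_nonneg n)
  interpolation x₁ x₂ y₁ y₂ h11 h12 h21 h22 := by
    rcases h11 with rfl | h11
    · exact ⟨x₁, le_rfl, h21, le_rfl, h12⟩
    rcases h12 with rfl | h12
    · exact ⟨x₁, le_rfl, h22, Or.inr h11, le_rfl⟩
    rcases h21 with rfl | h21
    · exact ⟨x₂, Or.inr h11, le_rfl, le_rfl, h22⟩
    rcases h22 with rfl | h22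
    · exact ⟨x₂, Or.inr h12, le_rfl, Or.inr h21, le_rfl⟩
    have c1 := continuous_eval x₁
    have c2 := continuous_eval x₂
    have c3 := continuous_eval y₁
    have c4 := continuous_eval y₂
    let lo : ℝ → ℝ := fun t => max (eval x₁ t) (eval x₂ t)
    let hi : ℝ → ℝ := fun t => min (eval y₁ t) (eval y₂ t)
    have hlo : Continuous lo := c1.max c2
    have hhi : Continuous hi := c3.min c4
    -- The gap `hi - lo` has a positive minimum, so an approximation of the midpoint within half of
    -- it stays strictly between.
    obtain ⟨t₀, ht₀, hmin⟩ := isCompact_Icc.exists_isMinOn ⟨a, left_mem_Icc.2 hab.le⟩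
      (hhi.sub hlo).continuousOn
    have hε : 0 < hi t₀ - lo t₀ := sub_pos.2 (max_lt (lt_min (h11 _ ht₀) (h12 _ ht₀))
      (lt_min (h21 _ ht₀) (h22 _ ht₀)))
    obtain ⟨p, hp⟩ := exists_int_poly_near hab hI (F := fun t => (lo t + hi t) / 2) (by fun_prop)
      (half_pos hε)
    have hp' : ∀ t ∈ Icc a b, lo t < Polynomial.aeval t p ∧ Polynomial.aeval t p < hi t := by
      intro t ht
      have h1 := abs_lt.1 (hp t ht)
      have h2 : hi t₀ - lo t₀ ≤ hi t - lo t := hmin ht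
      constructor <;> linarith [h1.1, h1.2]
    exact ⟨p, le_of_lt_eval fun t ht => (le_max_left _ _).trans_lt (hp' t ht).1,
      le_of_lt_eval fun t ht => (le_max_right _ _).trans_lt (hp' t ht).1,
      le_of_lt_eval fun t ht => (hp' t ht).2.trans_le (min_le_left _ _),
      le_of_lt_eval fun t ht => (hp' t ht).2.trans_le (min_le_right _ _)⟩

theorem isOrderUnit_of_pos {p : StrictPoly a b hab} (hp : 0 < p) : IsOrderUnit p := by
  have hpos : ∀ t ∈ Icc a b, 0 < eval p t := by
    intro t ht
    have := hp.le.resolve_left hp.ne t ht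
    rwa [eval_zero] at this
  obtain ⟨t₀, ht₀, hmin⟩ := isCompact_Icc.exists_isMinOn ⟨a, left_mem_Icc.2 hab.le⟩
    (continuous_eval p).continuousOn
  refine ⟨hp.le, fun q => ?_⟩
  obtain ⟨n, hn⟩ := exists_abs_eval_le q
  obtain ⟨m, hm⟩ := exists_nat_gt (n / eval p t₀)
  refine ⟨m, le_of_lt_eval fun t ht => ?_⟩
  rw [eval_nsmul]
  have h1 : (n : ℝ) < m * eval p t₀ := (div_lt_iff₀ (hpos _ ht₀)).1 hm
  have h2 : eval p t₀ ≤ eval p t := hmin ht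
  calc eval q t < n := (abs_lt.1 (hn t ht)).2
    _ ≤ m * eval p t₀ := h1.le
    _ ≤ m * eval p t := by gcongr

theorem isSimpleOrdered : IsSimpleOrdered (StrictPoly a b hab) := by
  refine ⟨inferInstanceAs (Nontrivial ℤ[X]), fun J hJ => ?_⟩
  by_cases h : ∃ p ∈ J, 0 < p
  · obtain ⟨p, hpJ, hp⟩ := h
    refine Or.inr (eq_top_iff.2 fun q _ => ?_)
    obtain ⟨n, hn⟩ := (isOrderUnit_of_pos hp).2 q
    obtain ⟨m, hm⟩ := (isOrderUnit_of_pos hp).2 (-q)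
    exact hJ.1.out (J.neg_mem (J.nsmul_mem hpJ m)) (J.nsmul_mem hpJ n) ⟨neg_le.1 hm, hn⟩
  · push Not at h
    refine Or.inl (eq_bot_iff.2 fun q hq => ?_)
    have hle : ∀ q ∈ J, q ≤ 0 := by
      intro q hq
      obtain ⟨z, hz, h0, hqz⟩ := hJ.2 0 J.zero_mem q hq
      have : z = 0 := by
        by_contra hne
        exact h z hz (h0.lt_of_ne (Ne.symm hne))
      exact this ▸ hqz
    exact AddSubgroup.mem_bot.2
      (le_antisymm (hle q hq) (neg_nonpos.1 (hle _ (J.neg_mem hq))))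

/-- A trace is bounded below by any lower bound of the values on the interval. -/
theorem le_trace {f : StrictPoly a b hab →+ ℝ} (hf : ∀ p, 0 ≤ p → 0 ≤ f p) (h1 : f 1 = 1)
    {p : StrictPoly a b hab} {c : ℝ} (hc : ∀ t ∈ Icc a b, c ≤ eval p t) : c ≤ f p := by
  refine le_of_forall_lt fun d hd => ?_
  obtain ⟨q, hdq, hqc⟩ := exists_rat_btwn hd
  have hden : (0 : ℝ) < q.den := by exact_mod_cast q.den_pos
  have hq : (q : ℝ) * q.den = q.num := by exact_mod_cast q.mul_den_eq_num
  -- Positivity of `p - q` for rational `q < c`, with the denominator cleared.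
  have := hf (q.den • p - q.num • 1) (le_of_lt_eval fun t ht => by
    rw [eval_zero, eval_sub, eval_nsmul, zsmul_eq_mul, mul_one, eval_intCast, ← hq]
    nlinarith [hc t ht])
  rw [map_sub, map_nsmul, map_zsmul, h1, nsmul_eq_mul, zsmul_eq_mul, mul_one, ← hq] at this
  have : (q : ℝ) ≤ f p := by
    by_contra hlt
    nlinarith
  linarith

theorem abs_trace_le {f : StrictPoly a b hab →+ ℝ} (hf : ∀ p, 0 ≤ p → 0 ≤ f p) (h1 : f 1 = 1)
    {p : StrictPoly a b hab} {c : ℝ} (hc : ∀ t ∈ Icc a b, |eval p t| ≤ c) : |f p| ≤ c := by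
  have e1 := le_trace hf h1 (p := p) (c := -c) fun t ht => (abs_le.1 (hc t ht)).1
  have e2 := le_trace hf h1 (p := 0 - p) (c := -c) fun t ht => by
    rw [eval_sub, eval_zero]; linarith [(abs_le.1 (hc t ht)).2]
  rw [map_sub, map_zero] at e2
  exact abs_le.2 ⟨e1, by linarith⟩

theorem eval_mem_traceSpace {t : ℝ} (ht : t ∈ Icc a b) :
    (fun p => eval p t) ∈ traceSpace (1 : StrictPoly a b hab) :=
  ⟨(evalHom t).toAddMonoidHom, rfl, fun p hp => by
    have := eval_le hp ht
    rwa [eval_zero] at this, eval_one t⟩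

/-- A variance argument: `(p - s)^2` vanishes at `t` for `s = p(t)`, so any trace `f` entering a
convex decomposition gives it value at most `0`, which forces `f p = s`. As `s` is real, the
inequalities are proved for rational constants and extended by density. -/
theorem eval_mem_pureTraces {t : ℝ} (ht : t ∈ Icc a b) :
    (fun p => eval p t) ∈ pureTraces (1 : StrictPoly a b hab) := by
  refine ⟨eval_mem_traceSpace ht, ?_⟩
  rintro _ ⟨f, rfl, hf, hf1⟩ _ ⟨g, rfl, hg, hg1⟩ ⟨v, w, hv, hw, hvw, h⟩
  have h' : ∀ p, v * f p + w * g p = eval p t := fun p => congrFun h p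
  ext p
  set A := f (p ^ 2)
  set B := f p
  set s := eval p t
  have hrat : ∀ q : ℚ, 0 ≤ A - 2 * q * B + q ^ 2 ∧ v * (A - 2 * q * B + q ^ 2) ≤ (s - q) ^ 2 := by
    intro q
    have hden : (0 : ℝ) < q.den := by exact_mod_cast q.den_pos
    have hq : (q.num : ℝ) = q * q.den := by exact_mod_cast q.mul_den_eq_num.symm
    let P : StrictPoly a b hab := (q.den * p - q.num) ^ 2
    have hP : P = (q.den ^ 2) • p ^ 2 - (2 * q.den * q.num) • p + (q.num ^ 2) • 1 := by
      simp only [P, nsmul_eq_mul, zsmul_eq_mul]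
      push_cast
      ring
    have hP0 : ∀ t ∈ Icc a b, 0 ≤ eval P t := fun t _ => by
      simp only [P, eval_pow]; positivity
    have hfP : f P = q.den ^ 2 * (A - 2 * q * B + q ^ 2) := by
      rw [hP, map_add, map_sub, map_nsmul, map_zsmul, map_zsmul, hf1]
      simp only [nsmul_eq_mul, zsmul_eq_mul]
      push_cast
      rw [hq]
      ring
    have hPt : eval P t = q.den ^ 2 * (s - q) ^ 2 := by
      simp only [P, eval_pow, eval_sub, eval_mul, eval_intCast, eval_natCast, hq]
      ring
    have i1 := le_trace hf hf1 hP0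
    have i2 := le_trace hg hg1 hP0
    have i3 := h' P
    rw [hPt, hfP] at i3
    rw [hfP] at i1
    have hd2 : (0 : ℝ) < q.den ^ 2 := by positivity
    refine ⟨nonneg_of_mul_nonneg_right i1 hd2, ?_⟩
    refine le_of_mul_le_mul_left ?_ hd2
    nlinarith [mul_nonneg hw.le i2]
  have hreal : ∀ r : ℝ, 0 ≤ A - 2 * r * B + r ^ 2 ∧ v * (A - 2 * r * B + r ^ 2) ≤ (s - r) ^ 2 := by
    intro r
    refine Rat.denseRange_cast.induction_on
      (p := fun r : ℝ => 0 ≤ A - 2 * r * B + r ^ 2 ∧ v * (A - 2 * r * B + r ^ 2) ≤ (s - r) ^ 2)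
      r ?_ hrat
    have c1 : Continuous fun r : ℝ => A - 2 * r * B + r ^ 2 := by fun_prop
    have c2 : Continuous fun r : ℝ => (s - r) ^ 2 := by fun_prop
    exact (isClosed_le continuous_const c1).inter (isClosed_le (c1.const_mul v) c2)
  -- Taking `r = B` gives `B^2 ≤ A`; taking `r = s` gives `A - 2sB + s^2 ≤ 0`.
  have k1 := (hreal B).1
  have k2 := (hreal s).2
  rw [sub_self, zero_pow two_ne_zero] at k2
  have k3 : A - 2 * s * B + s ^ 2 ≤ 0 := by
    by_contra hlt
    exact absurd k2 (not_le.2 (mul_pos hv (not_le.1 hlt)))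
  have k4 : (B - s) ^ 2 ≤ 0 := by nlinarith
  exact sub_eq_zero.1 (pow_eq_zero_iff two_ne_zero |>.1 (le_antisymm k4 (sq_nonneg _)))

/-- For `0 ≤ p ≤ N`, the map `g ↦ f (p * g) / N` is positive and dominated by `f`, hence a multiple
of `f`. A general `p` is shifted by a multiple of `1`. -/
theorem pure_map_mul {f : StrictPoly a b hab →+ ℝ} (hf : ⇑f ∈ pureTraces (1 : StrictPoly a b hab))
    (p q : StrictPoly a b hab) : f (p * q) = f p * f q := by
  have hpos : (∀ g, 0 ≤ g → 0 ≤ f g) ∧ f 1 = 1 := by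
    obtain ⟨⟨f', hf', h⟩, -⟩ := hf
    obtain rfl := DFunLike.coe_injective hf'
    exact h
  have key : ∀ p, 0 ≤ p → f (p * q) = f p * f q := by
    intro p hp
    obtain ⟨n, hn⟩ := isOrderUnit_one.2 p
    have hn1 : p ≤ (n + 1 : ℕ) • 1 :=
      hn.trans (nsmul_le_nsmul_left zero_le_one (Nat.le_add_right _ _))
    have hN : (0 : ℝ) < (n + 1 : ℕ) := by positivity
    let σ : StrictPoly a b hab →+ ℝ :=
      (AddMonoidHom.mulLeft ((n + 1 : ℕ) : ℝ)⁻¹).comp (f.comp (AddMonoidHom.mulLeft p))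
    have hσ : ∀ g, σ g = ((n + 1 : ℕ) : ℝ)⁻¹ * f (p * g) := fun _ => rfl
    have h := eq_mul_of_le_pure isOrderUnit_one hf (σ := σ)
      (fun g hg => by
        rw [hσ]
        exact mul_nonneg (inv_nonneg.2 hN.le) (hpos.1 _ (mul_nonneg hp hg)))
      (fun g hg => by
        rw [hσ, inv_mul_le_iff₀ hN]
        have h1 := hpos.1 _ (sub_nonneg.2 (mul_le_mul_of_nonneg_right hn1 hg))
        rw [map_sub, smul_one_mul, map_nsmul, nsmul_eq_mul] at h1
        linarith) q
    rw [hσ, hσ, mul_one, mul_assoc] at h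
    exact mul_left_cancel₀ (inv_ne_zero hN.ne') h
  obtain ⟨n, hn⟩ := isOrderUnit_one.2 (-p)
  have h1 := key (n • 1 + p) (by rwa [← neg_le_iff_add_nonneg])
  have h2 := key (n • 1) (nsmul_nonneg zero_le_one n)
  rw [add_mul, map_add, map_add, h2] at h1
  linarith

theorem exists_eval_of_pure {τ : StrictPoly a b hab → ℝ}
    (hτ : τ ∈ pureTraces (1 : StrictPoly a b hab)) :
    ∃ t ∈ Icc a b, (fun p => eval p t) = τ := by
  obtain ⟨f, rfl, hf, h1⟩ := hτ.1
  let F : ℤ[X] →+* ℝ :=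
    { f with
      map_one' := h1
      map_mul' := pure_map_mul hτ }
  let X : StrictPoly a b hab := (Polynomial.X : ℤ[X])
  have hX : ∀ t, eval X t = t := fun t => Polynomial.aeval_X t
  have hF : ∀ p : StrictPoly a b hab, f p = eval p (f X) := by
    have : F = (Polynomial.aeval (R := ℤ) (f X) : ℤ[X] →ₐ[ℤ] ℝ).toRingHom := by
      refine Polynomial.ringHom_ext (fun n => by simp) ?_
      exact (Polynomial.aeval_X (R := ℤ) (f X)).symm
    exact fun p => congrArg (fun φ : ℤ[X] →+* ℝ => φ p) this
  refine ⟨f X, ⟨?_, ?_⟩, funext fun p => (hF p).symm⟩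
  · exact le_trace hf h1 fun t ht => by rw [hX]; exact ht.1
  · have := le_trace hf h1 (p := 0 - X) (c := -b) fun t ht => by
      rw [eval_sub, eval_zero, hX]; linarith [ht.2]
    rw [map_sub, map_zero] at this
    linarith

theorem exists_homeomorph_pureTraces : ∃ e : Icc a b ≃ₜ pureTraces (1 : StrictPoly a b hab),
    ∀ (t : Icc a b) (p : StrictPoly a b hab), (e t : StrictPoly a b hab → ℝ) p = p.eval t := by
  let φ : Icc a b → pureTraces (1 : StrictPoly a b hab) := fun t =>
    ⟨fun p => eval p t, eval_mem_pureTraces t.2⟩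
  have hφ : Continuous φ := by
    refine Continuous.subtype_mk (continuous_pi fun p => ?_) _
    exact (continuous_eval p).comp continuous_subtype_val
  have hbij : Function.Bijective φ := by
    constructor
    · intro s t hst
      have := congrFun (congrArg Subtype.val hst) (Polynomial.X : ℤ[X])
      have hX : ∀ t : ℝ, eval (hab := hab) (Polynomial.X : ℤ[X]) t = t :=
        fun t => Polynomial.aeval_X t
      simp only [φ, hX] at this
      exact Subtype.ext this
    · rintro ⟨τ, hτ⟩
      obtain ⟨t, ht, rfl⟩ := exists_eval_of_pure hτ
      exact ⟨⟨t, ht⟩, rfl⟩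
  exact ⟨hφ.homeoOfEquivCompactToT2 (f := Equiv.ofBijective φ hbij), fun t p => rfl⟩

theorem isLUB_pseudoNorm (p : StrictPoly a b hab) :
    IsLUB ((fun t => |p.eval t|) '' Icc a b) (pseudoNorm (1 : StrictPoly a b hab) p) := by
  constructor
  · rintro _ ⟨t, ht, rfl⟩
    exact le_pseudoNorm isOrderUnit_one p (eval_mem_traceSpace ht)
  · intro c hc
    have hc' : ∀ t ∈ Icc a b, |eval p t| ≤ c := fun t ht => hc ⟨t, ht, rfl⟩
    refine pseudoNorm_le ((abs_nonneg _).trans (hc' a (left_mem_Icc.2 hab.le))) ?_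
    rintro _ ⟨f, rfl, hf, h1⟩
    exact abs_trace_le hf h1 hc'

/-- Integer coefficients are recovered linearly from the values on the interval. -/
theorem exists_coeff_functional (hab : a < b) (j : ℕ) : ∃ K : (Icc a b → ℝ) →ₗ[ℝ] ℝ,
    ∀ p : StrictPoly a b hab, K (fun t => eval p t) = ((Polynomial.coeff (R := ℤ) p j : ℤ) : ℝ) := by
  let E : ℝ[X] →ₗ[ℝ] (Icc a b → ℝ) := LinearMap.pi fun t => Polynomial.leval (t : ℝ)
  have hE : LinearMap.ker E = ⊥ := by
    rw [LinearMap.ker_eq_bot']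
    intro p hp
    refine Polynomial.eq_zero_of_infinite_isRoot p ((Icc_infinite hab).mono fun t ht => ?_)
    exact congrFun hp ⟨t, ht⟩
  -- A purely algebraic left inverse; no continuity of the coefficient functional is needed.
  obtain ⟨J, hJ⟩ := E.exists_leftInverse_of_injective hE
  refine ⟨(Polynomial.lcoeff ℝ j).comp J, fun p => ?_⟩
  have h1 : (fun t : Icc a b => eval p t) = E (Polynomial.map (Int.castRingHom ℝ) (p : ℤ[X])) := by
    ext t
    exact (Polynomial.eval_map_algebraMap (R := ℤ) (p : ℤ[X]) (t : ℝ)).symm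
  have h2 : ∀ q, J (E q) = q := LinearMap.congr_fun hJ
  rw [h1, LinearMap.comp_apply, h2]
  exact Polynomial.coeff_map (R := ℤ) _ _

/-- A homomorphism to `ℤ[x]` from an approximately divisible dimension group with finitely many
pure traces vanishes if its compositions with all point evaluations are continuous. -/
theorem eq_zero_of_continuous_eval {G : Type*} [AddCommGroup G] [PartialOrder G]
    (hG : IsDimensionGroup G) {u : G} (hu : IsOrderUnit u) (hd : IsApproximatelyDivisible u)
    (hfin : (pureTraces u).Finite) (ψ : G →+ StrictPoly a b hab)
    (hψ : ∀ t ∈ Icc a b, IsContinuousReal u ((evalHom t).toAddMonoidHom.comp ψ)) : ψ = 0 := by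
  have := hG.isOrdered
  have := hfin.fintype
  choose f hfτ hf0 using fun τ : pureTraces u => τ.2.1
  have hfp : ∀ τ, ⇑(f τ) ∈ pureTraces u := fun τ => by rw [hfτ]; exact τ.2
  have hinj : Function.Injective f := fun σ τ h => Subtype.ext (by rw [← hfτ, ← hfτ, h])
  have hT := denseRange_pi_of_pure hG hu hfp hinj fun τ => by rw [hfτ]; exact hd _ τ.2
  set T := AddMonoidHom.pi f
  have hpn : ∀ g, pseudoNorm u g ≤ ‖T g‖ := fun g =>
    pseudoNorm_le_of_pure hu (norm_nonneg _) fun τ hτ => by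
      have := norm_le_pi_norm (T g) ⟨τ, hτ⟩
      rw [Real.norm_eq_abs] at this
      have e : T g ⟨τ, hτ⟩ = τ g := congrFun (hfτ ⟨τ, hτ⟩) g
      rwa [e] at this
  have hL : ∀ t : Icc a b, ∃ L : (pureTraces u → ℝ) →ₗ[ℝ] ℝ, ∀ g, L (T g) = eval (ψ g) t := by
    intro t
    refine exists_linearMap_of_denseRange T hT ((evalHom t).toAddMonoidHom.comp ψ) fun ε hε => ?_
    obtain ⟨δ, hδ, h⟩ := hψ t t.2 0 ε hε
    refine ⟨δ, hδ, fun g hg => ?_⟩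
    have := h g (by rw [sub_zero]; exact (hpn g).trans_lt hg)
    rwa [map_zero, sub_zero] at this
  choose L hL using hL
  ext1 g
  refine Polynomial.ext (R := ℤ) fun j => ?_
  obtain ⟨K, hK⟩ := exists_coeff_functional hab j
  -- The `j`-th coefficient of `ψ g` is thus linear in `T g`, and it is an integer.
  have hKT : ∀ g, K.comp (LinearMap.pi L) (T g) = ((Polynomial.coeff (R := ℤ) (ψ g) j : ℤ) : ℝ) := by
    intro g
    rw [← hK, LinearMap.comp_apply]
    congr 1
    ext t
    exact hL t g
  have hz := linearMap_eq_zero_of_denseRange_int T hT (K.comp (LinearMap.pi L))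
    fun g => ⟨_, hKT g⟩
  have := hKT g
  rw [hz, LinearMap.zero_apply] at this
  have h0 : Polynomial.coeff (R := ℤ) (ψ g) j = 0 := by exact_mod_cast this.symm
  exact h0

end StrictPoly

end DimGroup

/-! ### Direct limits, weak continuity and the vanishing theorems. -/

namespace DimGroup

open Set

theorem OrderedSystem.HasLimit.exists_maps {S : OrderedSystem.{w₂, w₃}} {H : Type*}
    [AddCommGroup H] [PartialOrder H] (hS : S.HasLimit H) :
    ∃ ψ : ∀ i, S.Gp i →+ H, (∀ i g, 0 ≤ g → 0 ≤ ψ i g) ∧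
      ∀ x y : H, ∃ i g h, ψ i g = x ∧ ψ i h = y := by
  obtain ⟨e, he⟩ := hS
  refine ⟨fun i => AddMonoidHom.mk' (fun g => e ⟦⟨i, g⟩⟧) fun g h => ?_, fun i g hg => ?_,
    fun x y => ?_⟩
  · rw [← map_add, DirectLimit.add_def]
  · exact (he _).2 ⟨i, g, hg, rfl⟩
  · obtain ⟨i, g, h, hg, hh⟩ := DirectLimit.exists_eq_mk₂ S.map (e.symm x) (e.symm y)
    exact ⟨i, g, h, by simp [← hg], by simp [← hh]⟩

section Continuity

variable {G H : Type*} [AddCommGroup G] [PartialOrder G] [AddCommGroup H] [PartialOrder H]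

theorem isContinuousReal_of_le {u : G} {f : G →+ ℝ} {c : ℝ}
    (h : ∀ g, |f g| ≤ c * pseudoNorm u g) : IsContinuousReal u f := by
  intro g ε hε
  have hc : 0 < |c| + 1 := by positivity
  refine ⟨ε / (|c| + 1), by positivity, fun g' hg' => ?_⟩
  rw [← map_sub]
  rw [lt_div_iff₀ hc] at hg'
  nlinarith [h (g' - g), le_abs_self c, pseudoNorm_nonneg u (g' - g)]

/-- Composition with a homomorphism bounded for the pseudo-norms preserves continuity. -/
theorem IsContinuousReal.comp_of_le {u : G} {v : H} {ρ : H →+ ℝ} (hρ : IsContinuousReal v ρ)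
    {φ : G →+ H} {c : ℝ} (h : ∀ g, pseudoNorm v (φ g) ≤ c * pseudoNorm u g) :
    IsContinuousReal u (ρ.comp φ) := by
  intro g ε hε
  obtain ⟨δ, hδ, hδ'⟩ := hρ (φ g) ε hε
  have hc : 0 < |c| + 1 := by positivity
  refine ⟨δ / (|c| + 1), by positivity, fun g' hg' => hδ' _ ?_⟩
  rw [← map_sub]
  rw [lt_div_iff₀ hc] at hg'
  nlinarith [h (g' - g), le_abs_self c, pseudoNorm_nonneg u (g' - g)]

theorem IsContinuousHom.isWeaklyContinuousHom {u : G} {v : H} {φ : G →+ H}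
    (hφ : IsContinuousHom u v φ) : IsWeaklyContinuousHom u v φ := by
  intro ρ hρ g ε hε
  obtain ⟨δ, hδ, h⟩ := hρ (φ g) ε hε
  obtain ⟨η, hη, h'⟩ := hφ g δ hδ
  exact ⟨η, hη, fun g' hg' => h _ (h' g' hg')⟩

/-- Positive homomorphisms are bounded for the pseudo-norms. -/
theorem exists_pseudoNorm_map_le [IsOrderedAddMonoid G] [IsOrderedAddMonoid H] {u : G} {v : H}
    (hu : IsOrderUnit u) (hv : IsOrderUnit v) (φ : G →+ H) (hφ : ∀ g, 0 ≤ g → 0 ≤ φ g) :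
    ∃ c, ∀ g, pseudoNorm v (φ g) ≤ c * pseudoNorm u g := by
  obtain ⟨n, hn⟩ := hv.2 (φ u)
  refine ⟨n, fun g => pseudoNorm_le (mul_nonneg n.cast_nonneg (pseudoNorm_nonneg u g)) ?_⟩
  rintro _ ⟨f, rfl, hf, h1⟩
  have hfu : f (φ u) ≤ n := by
    have := hf _ (sub_nonneg.2 hn)
    rw [map_sub, map_nsmul, h1, nsmul_eq_mul] at this
    linarith
  calc |f (φ g)| ≤ f (φ u) * pseudoNorm u g :=
        abs_le_mul_pseudoNorm hu (f := f.comp φ) (fun g hg => hf _ (hφ g hg)) g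
    _ ≤ n * pseudoNorm u g := mul_le_mul_of_nonneg_right hfu (pseudoNorm_nonneg u g)

end Continuity

namespace StrictPoly

variable {a b : ℝ} {hab : a < b}

theorem isContinuousReal_eval {t : ℝ} (ht : t ∈ Icc a b) :
    IsContinuousReal (1 : StrictPoly a b hab) (evalHom t).toAddMonoidHom :=
  isContinuousReal_of_le (c := 1) fun p => by
    rw [one_mul]
    exact le_pseudoNorm isOrderUnit_one p (eval_mem_traceSpace ht)

theorem eq_zero_of_isWeaklyContinuousHom {H : Type w₁} [AddCommGroup H] [PartialOrder H]
    (hH : IsProFD.{w₁, w₂, w₃} H) {u : H} (hu : IsOrderUnit u) (φ : H →+ StrictPoly a b hab)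
    (hφ : IsWeaklyContinuousHom u 1 φ) : φ = 0 := by
  obtain ⟨hHd, S, v, hS, -, hlim⟩ := hH
  have := hHd.isOrdered
  obtain ⟨ψ, hψ, hsurj⟩ := hlim.exists_maps
  ext1 x
  obtain ⟨i, g, -, rfl, -⟩ := hsurj x x
  obtain ⟨hG, hv, hd, hfin⟩ := hS i
  obtain ⟨c, hc⟩ := exists_pseudoNorm_map_le hv hu (ψ i) (hψ i)
  have h0 := eq_zero_of_continuous_eval hG hv hd hfin (φ.comp (ψ i)) fun t ht =>
    (hφ _ (isContinuousReal_eval ht)).comp_of_le hc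
  exact DFunLike.congr_fun h0 g

theorem isWeaklyContinuousHom_of_monotone {G : Type*} [AddCommGroup G] [PartialOrder G]
    [IsOrderedAddMonoid G] {u : G} (hu : IsOrderUnit u) (φ : G →+ StrictPoly a b hab)
    (hφ : ∀ g, 0 ≤ g → 0 ≤ φ g) : IsWeaklyContinuousHom u 1 φ := by
  obtain ⟨c, hc⟩ := exists_pseudoNorm_map_le hu isOrderUnit_one φ hφ
  exact fun ρ hρ => hρ.comp_of_le hc

theorem isStronglyAntiFD (hI : ∀ n : ℤ, (n : ℝ) ∉ Icc a b) :
    IsStronglyAntiFD.{w₁, w₂, w₃} (1 : StrictPoly a b hab) :=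
  ⟨isDimensionGroup hI, isOrderUnit_one, fun _ _ _ hH _ hu φ hφ =>
    eq_zero_of_isWeaklyContinuousHom hH hu φ hφ.isWeaklyContinuousHom⟩

/-- `1` and `X` are linearly independent over `ℤ`, so no cyclic subgroup contains both. -/
theorem not_exists_zsmul_one_X (p : StrictPoly a b hab) (m k : ℤ) (h1 : m • p = 1) :
    k • p ≠ (Polynomial.X : ℤ[X]) := by
  intro hX
  have h : k • (1 : ℤ[X]) = m • Polynomial.X := by
    have : k • (1 : StrictPoly a b hab) = m • (k • p) := by rw [← h1, smul_comm]
    rw [hX] at this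
    exact this
  have hm := congrArg (fun q : ℤ[X] => q.coeff 1) h
  simp only [Polynomial.coeff_smul, Polynomial.coeff_one, Polynomial.coeff_X_one, one_ne_zero,
    if_false, smul_eq_mul, mul_zero, mul_one] at hm
  rw [← hm, zero_smul] at h1
  exact zero_ne_one h1

theorem not_hasLimit (S : OrderedSystem.{w₂, w₃})
    (hS : ∀ i, IsDimensionGroup (S.Gp i) ∧ IsSimpleOrdered (S.Gp i) ∧
      ∃ u : S.Gp i, IsOrderUnit u ∧ (pureTraces u).Finite) :
    ¬ S.HasLimit (StrictPoly a b hab) := by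
  intro hlim
  obtain ⟨ψ, hψ, hsurj⟩ := hlim.exists_maps
  obtain ⟨i, g, h, hg, hh⟩ := hsurj 1 (Polynomial.X : ℤ[X])
  obtain ⟨hG, hs, u, hu, hfin⟩ := hS i
  by_cases hd : IsApproximatelyDivisible u
  · have h0 := eq_zero_of_continuous_eval hG hu hd hfin (ψ i) fun t ht =>
      isWeaklyContinuousHom_of_monotone hu (ψ i) (hψ i) _ (isContinuousReal_eval ht)
    rw [h0] at hg
    exact zero_ne_one hg
  · rw [IsApproximatelyDivisible] at hd
    push Not at hd
    -- A trace without dense range makes this simple stage cyclic, yet its image contains `1` and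
    -- `X`.
    obtain ⟨_, ⟨⟨f, rfl, hf, hf1⟩, -⟩, hnd⟩ := hd
    obtain ⟨p, hp⟩ := exists_zsmul_of_not_dense hG hs hu hf hf1 hnd
    obtain ⟨m, rfl⟩ := hp g
    obtain ⟨k, rfl⟩ := hp h
    rw [map_zsmul] at hg hh
    exact not_exists_zsmul_one_X _ m k hg hh

end StrictPoly

end DimGroup

theorem mainTheorem1 (a b : ℝ) (hab : a < b)
    (hI : ∀ n : ℤ, (n : ℝ) ∉ Set.Icc a b) :
    -- `ℤ[x]` with the strict ordering is an ordered ring and a simple dimension group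
    -- with order unit `1`
    IsOrderedRing (StrictPoly a b hab) ∧
    IsDimensionGroup (StrictPoly a b hab) ∧
    IsSimpleOrdered (StrictPoly a b hab) ∧
    IsOrderUnit (1 : StrictPoly a b hab) ∧
    -- the pure trace space is `[a, b]`, through point evaluations
    (∃ e : Set.Icc a b ≃ₜ pureTraces (1 : StrictPoly a b hab),
      ∀ (t : Set.Icc a b) (p : StrictPoly a b hab),
        (e t : StrictPoly a b hab → ℝ) p = p.eval t) ∧
    -- the pseudo-norm is the supremum norm on `[a, b]`
    (∀ p : StrictPoly a b hab,
      IsLUB ((fun t => |p.eval t|) '' Set.Icc a b) (pseudoNorm (1 : StrictPoly a b hab) p)) ∧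
    -- continuous homomorphisms from pro-finite dimensional groups vanish
    IsStronglyAntiFD.{w₁, w₂, w₃} (1 : StrictPoly a b hab) ∧
    -- weakly continuous ones vanish, and positive ones are weakly continuous, so vanish too
    (∀ (H : Type w₁) [AddCommGroup H] [PartialOrder H], IsProFD.{w₁, w₂, w₃} H →
      ∀ u : H, IsOrderUnit u → ∀ φ : H →+ StrictPoly a b hab,
        (IsWeaklyContinuousHom u 1 φ → φ = 0) ∧
        (Monotone φ → IsWeaklyContinuousHom u 1 φ ∧ φ = 0)) ∧
    -- not a direct limit of simple dimension groups with finitely many pure traces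
    (∀ S : OrderedSystem.{w₂, w₃},
      (∀ i, IsDimensionGroup (S.Gp i) ∧ IsSimpleOrdered (S.Gp i) ∧
        ∃ u : S.Gp i, IsOrderUnit u ∧ (pureTraces u).Finite) →
      ¬ S.HasLimit (StrictPoly a b hab)) := by
  refine ⟨inferInstance, StrictPoly.isDimensionGroup hI, StrictPoly.isSimpleOrdered,
    StrictPoly.isOrderUnit_one, StrictPoly.exists_homeomorph_pureTraces,
    StrictPoly.isLUB_pseudoNorm, StrictPoly.isStronglyAntiFD hI,
    fun H _ _ hH u hu φ => ⟨StrictPoly.eq_zero_of_isWeaklyContinuousHom hH hu φ, fun hφ => ?_⟩,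
    StrictPoly.not_hasLimit⟩
  have := hH.1.isOrdered
  have hw := StrictPoly.isWeaklyContinuousHom_of_monotone hu φ
    fun g hg => by simpa using hφ hg
  exact ⟨hw, StrictPoly.eq_zero_of_isWeaklyContinuousHom hH hu φ hw⟩
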